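/- Let $\mathfrak h^*$ be a finite-dimensional real Euclidean space with inner product $(\cdot,\cdot)$, let $\Delta\subset\mathfrak h^*$ be a finite reduced (not necessarily crystallographic) root system, that is, a finite set of nonzero vectors with $\Delta\cap\mathbb R\alpha=\{\alpha,-\alpha\}$ and $s_\alpha(\Delta)=\Delta$ for all $\alpha\in\Delta$, where $s_\alpha$ is the orthogonal reflection in the hyperplane $\alpha^\perp$. Let $W$ be the finite Coxeter group generated by the $s_\alpha$, let $\Delta_+$ be a set of positive roots (the roots on which some linear form, non-vanishing on $\Delta$, is positive), and let $R=\mathrm{Sym}\,\mathfrak h^*$. Let $V=\bigoplus_{\alpha\in\Delta}\mathbb R[\alpha]/([\alpha]+[-\alpha])$ be the Yetter–Drinfeld module over $W$ in which $w[\alpha]=[w\alpha]$ and $[\alpha]$ is homogeneous of degree $s_\alpha$, so that its braiding is $\Psi([\alpha]\otimes[\beta])=[s_\alpha\beta]\otimes[\alpha]$, and let $\mathcal B_W=T(V)/\bigoplus_n\ker\mathfrak S_n$ be its Nichols–Woronowicz algebra, where $\mathfrak S_n$ is the quantum symmetrizer of $\Psi$ on $V^{\otimes n}$. Let $\mathcal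 B_W\langle R\rangle[t]$ be the real algebra generated by $\mathcal B_W$ and the polynomial ring $R[t]$ subject to the relations $[\alpha]t=t[\alpha]$ and $$[\alpha]x=s_\alpha(x)[\alpha]+t\,(x,\alpha)\qquad(\alpha\in\Delta,\ x\in\mathfrak h^*),$$ and let $\widetilde{\mathcal B}_W=\mathcal B_W\langle R\rangle[t]\otimes_{R^W}R$. Let $(c_\alpha)_{\alpha\in\Delta}$ be real constants with $c_{w\alpha}=c_\alpha$ for all $w\in W$, and put $$\mu(x)=x+\sum_{\alpha\in\Delta_+}c_\alpha\,(x,\alpha)\,[\alpha]\qquad(x\in\mathfrak h^*).$$ Then $\mu(x)\mu(y)=\mu(y)\mu(x)$ for all $x,y\in\mathfrak h^*$, both in $\mathcal B_W\langle R\rangle[t]$ and (for the images under $a\mapsto a\otimes1$) in $\widetilde{\mathcal B}_W$. Hence the linear map $\mu$ extends to a homomorphism of $\mathbb R$-algebras $R\to\mathcal B_W\langle R\rangle[t]$. -/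

import Mathlib

open scoped TensorProduct InnerProductSpace

noncomputable section

namespace NicholsWoronowicz

/-! ### Nichols–Woronowicz algebra of a braided vector space -/

section Braided

variable {k V : Type*} [Field k] [AddCommGroup V] [Module k V]

/-- `u ⊗ v ↦ u * d v` in the tensor algebra. -/
def mulTensor (d : V →ₗ[k] TensorAlgebra k V) : V ⊗[k] V →ₗ[k] TensorAlgebra k V :=
  LinearMap.mul' k (TensorAlgebra k V) ∘ₗ TensorProduct.map (TensorAlgebra.ι k) d

@[simp] theorem mulTensor_tmul (d : V →ₗ[k] TensorAlgebra k V) (u v : V) :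
    mulTensor d (u ⊗ₜ[k] v) = TensorAlgebra.ι k u * d v := by
  simp [mulTensor]

/-- One step of the recursion for the insertion operators: from a tensor `w` together with the map
`d : v ↦ (insertion of v into w)`, and a vector `u`, it produces `u w` together with
`v ↦ v u w + ∑ u' * d v'`, where `Ψ (v ⊗ u) = ∑ u' ⊗ v'`. -/
def insertStep (Ψ : V ⊗[k] V →ₗ[k] V ⊗[k] V) :
    V →ₗ[k] Module.End k (TensorAlgebra k V × (V →ₗ[k] TensorAlgebra k V)) :=
  LinearMap.mk₂ k
    (fun u p =>
      (TensorAlgebra.ι k u * p.1,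
        LinearMap.mulRight k (TensorAlgebra.ι k u * p.1) ∘ₗ TensorAlgebra.ι k +
          mulTensor p.2 ∘ₗ Ψ ∘ₗ (TensorProduct.mk k V V).flip u))
    (by
      intro u u' p
      ext v
      · simp [add_mul]
      · simp [add_mul, mul_add, mul_assoc]; abel)
    (by
      intro a u p
      ext v <;> simp [mul_assoc])
    (by
      intro u p q
      ext v
      · simp [mul_add]
      · simp [mul_add, mul_assoc, mulTensor, TensorProduct.map_add_right]; abel)
    (by
      intro a u p
      ext v
      · simp
      · simp [mulTensor, mul_assoc, TensorProduct.map_smul_right])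

/-- The insertion (braided shuffle) operators on the tensor algebra of a braided vector space
`(V, Ψ)`: on `V ⊗ V^{⊗ m}` it is `1 + Ψ₁ + Ψ₂Ψ₁ + ⋯ + Ψₘ⋯Ψ₂Ψ₁`, where `Ψᵢ` is `Ψ` acting on the
tensor factors `i` and `i + 1`. See `insert_one` and `insert_ι_mul` for the recursion. -/
def insert (Ψ : V ⊗[k] V →ₗ[k] V ⊗[k] V) :
    TensorAlgebra k V →ₗ[k] V →ₗ[k] TensorAlgebra k V :=
  LinearMap.snd k _ _ ∘ₗ
    LinearMap.applyₗ ((1 : TensorAlgebra k V), (TensorAlgebra.ι k : V →ₗ[k] TensorAlgebra k V)) ∘ₗ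
      (TensorAlgebra.lift k (insertStep Ψ)).toLinearMap

theorem insert_aux (Ψ : V ⊗[k] V →ₗ[k] V ⊗[k] V) (w : TensorAlgebra k V) :
    (TensorAlgebra.lift k (insertStep Ψ) w
      ((1 : TensorAlgebra k V), (TensorAlgebra.ι k : V →ₗ[k] TensorAlgebra k V))).1 = w := by
  have key : ∀ (w z : TensorAlgebra k V) (d : V →ₗ[k] TensorAlgebra k V),
      (TensorAlgebra.lift k (insertStep Ψ) w (z, d)).1 = w * z := by
    intro w
    induction w using TensorAlgebra.induction with
    | algebraMap r => intro z d; simp [Algebra.smul_def]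
    | ι x => intro z d; simp [insertStep]
    | mul a b ha hb =>
      intro z d
      rw [map_mul, Module.End.mul_apply, mul_assoc, ← hb z d, ← ha]
    | add a b ha hb => intro z d; simp [ha, hb, add_mul]
  simpa using key w 1 _

theorem insert_one (Ψ : V ⊗[k] V →ₗ[k] V ⊗[k] V) (v : V) :
    insert Ψ 1 v = TensorAlgebra.ι k v := by
  simp [insert]

theorem insertStep_apply_snd (Ψ : V ⊗[k] V →ₗ[k] V ⊗[k] V) (u v : V)
    (p : TensorAlgebra k V × (V →ₗ[k] TensorAlgebra k V)) :
    (insertStep Ψ u p).2 v =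
      TensorAlgebra.ι k v * (TensorAlgebra.ι k u * p.1) + mulTensor p.2 (Ψ (v ⊗ₜ[k] u)) := by
  simp [insertStep, mul_assoc]

theorem insert_ι_mul (Ψ : V ⊗[k] V →ₗ[k] V ⊗[k] V) (u v : V) (w : TensorAlgebra k V) :
    insert Ψ (TensorAlgebra.ι k u * w) v =
      TensorAlgebra.ι k v * (TensorAlgebra.ι k u * w) +
        mulTensor (insert Ψ w) (Ψ (v ⊗ₜ[k] u)) := by
  simp only [insert, LinearMap.comp_apply, AlgHom.toLinearMap_apply, map_mul,
    TensorAlgebra.lift_ι_apply, LinearMap.applyₗ_apply_apply, Module.End.mul_apply,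
    LinearMap.snd_apply, insertStep_apply_snd, insert_aux]

/-- The Woronowicz quantum symmetrizer of `(V, Ψ)`, on all degrees at once. On `V^{⊗ n}` it is
`∑_{w ∈ Sₙ} T_w`, where `T_w = Ψ_{i₁} ⋯ Ψ_{iₗ}` for a reduced word `w = s_{i₁} ⋯ s_{iₗ}`; it is given
by the factorization `𝔖ₙ = (1 + Ψ₁ + Ψ₂Ψ₁ + ⋯ + Ψₙ₋₁⋯Ψ₁) (id ⊗ 𝔖ₙ₋₁)`. -/
def quantumSymmetrizer (Ψ : V ⊗[k] V →ₗ[k] V ⊗[k] V) :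
    TensorAlgebra k V →ₗ[k] TensorAlgebra k V :=
  LinearMap.applyₗ (1 : TensorAlgebra k V) ∘ₗ
    (TensorAlgebra.lift k
      ((insert Ψ).flip : V →ₗ[k] Module.End k (TensorAlgebra k V))).toLinearMap

theorem quantumSymmetrizer_one (Ψ : V ⊗[k] V →ₗ[k] V ⊗[k] V) :
    quantumSymmetrizer Ψ 1 = 1 := by
  simp [quantumSymmetrizer]

theorem quantumSymmetrizer_ι_mul (Ψ : V ⊗[k] V →ₗ[k] V ⊗[k] V) (v : V) (w : TensorAlgebra k V) :
    quantumSymmetrizer Ψ (TensorAlgebra.ι k v * w) = insert Ψ (quantumSymmetrizer Ψ w) v := by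
  simp [quantumSymmetrizer]

/-- The Nichols–Woronowicz algebra `T(V) / ⨁ₙ ker 𝔖ₙ` of a braided vector space `(V, Ψ)`: the
quotient of the tensor algebra by the (two-sided ideal generated by the) kernel of the quantum
symmetrizer. -/
def NicholsAlgebra (Ψ : V ⊗[k] V →ₗ[k] V ⊗[k] V) : Type _ :=
  RingQuot fun a b : TensorAlgebra k V => quantumSymmetrizer Ψ a = quantumSymmetrizer Ψ b

instance (Ψ : V ⊗[k] V →ₗ[k] V ⊗[k] V) : Ring (NicholsAlgebra Ψ) :=
  inferInstanceAs (Ring (RingQuot _))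

instance (Ψ : V ⊗[k] V →ₗ[k] V ⊗[k] V) : Algebra k (NicholsAlgebra Ψ) :=
  inferInstanceAs (Algebra k (RingQuot _))

/-- The quotient map `T(V) → 𝓑(V)`. -/
def NicholsAlgebra.mk (Ψ : V ⊗[k] V →ₗ[k] V ⊗[k] V) : TensorAlgebra k V →ₐ[k] NicholsAlgebra Ψ :=
  RingQuot.mkAlgHom k _

/-- The inclusion of generators `V → 𝓑(V)`. -/
def NicholsAlgebra.ι (Ψ : V ⊗[k] V →ₗ[k] V ⊗[k] V) : V →ₗ[k] NicholsAlgebra Ψ :=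
  (NicholsAlgebra.mk Ψ).toLinearMap ∘ₗ TensorAlgebra.ι k

end Braided

/-! ### Yetter–Drinfeld modules over a group -/

/-- A (left-left) Yetter–Drinfeld module structure on `V` over the group algebra `k[G]`: a
representation of `G` together with a `G`-grading, recorded by the map `coaction` which sends `v` to
the family of its homogeneous components, such that `g` maps the component of degree `h` to the
component of degree `g h g⁻¹`. -/
structure YetterDrinfeld (k G V : Type*) [Field k] [Group G] [AddCommGroup V] [Module k V] where
  action : Representation k G V
  coaction : V →ₗ[k] (G →₀ V)
  sum_coaction : ∀ v, ((coaction v).sum fun _ u => u) = v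
  coaction_component : ∀ v g, coaction (coaction v g) = Finsupp.single g (coaction v g)
  coaction_action : ∀ g h v, coaction (action g v) (g * h * g⁻¹) = action g (coaction v h)

/-- The braiding `Ψ (v ⊗ u) = ∑_g (g • u) ⊗ v_g` of a Yetter–Drinfeld module, where `v_g` is the
component of `v` of degree `g`. -/
def YetterDrinfeld.braiding {k G V : Type*} [Field k] [Group G] [AddCommGroup V] [Module k V]
    (Y : YetterDrinfeld k G V) : V ⊗[k] V →ₗ[k] V ⊗[k] V :=
  TensorProduct.lift
    ((Finsupp.lsum k fun g : G =>
        ((TensorProduct.mk k V V).flip.compl₂ (Y.action g) : V →ₗ[k] V →ₗ[k] V ⊗[k] V)) ∘ₗ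
      Y.coaction)

theorem YetterDrinfeld.braiding_tmul {k G V : Type*} [Field k] [Group G] [AddCommGroup V]
    [Module k V] (Y : YetterDrinfeld k G V) (v u : V) :
    Y.braiding (v ⊗ₜ[k] u) = (Y.coaction v).sum fun g vg => Y.action g u ⊗ₜ[k] vg := by
  simp [YetterDrinfeld.braiding, Finsupp.sum, LinearMap.sum_apply]

/-! ### Root systems and finite reflection groups -/

/-- The orthogonal reflection in the hyperplane orthogonal to `α`. -/
abbrev refl {E : Type*} [NormedAddCommGroup E] [InnerProductSpace ℝ E] (α : E) : E ≃ₗᵢ[ℝ] E :=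
  (ℝ ∙ α)ᗮ.reflection

/-- A finite reduced (not necessarily crystallographic) root system in a Euclidean space. The
roots may have arbitrary lengths, and they are not required to span the space. -/
structure EuclideanRootSystem (E : Type*) [NormedAddCommGroup E] [InnerProductSpace ℝ E] where
  roots : Finset E
  ne_zero : ∀ α ∈ roots, α ≠ 0
  reduced : ∀ α ∈ roots, ∀ r : ℝ, r • α ∈ roots → r = 1 ∨ r = -1
  refl_mem : ∀ α ∈ roots, ∀ β ∈ roots, refl α β ∈ roots

namespace EuclideanRootSystem

variable {E : Type*} [NormedAddCommGroup E] [InnerProductSpace ℝ E] (Φ : EuclideanRootSystem E)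

theorem neg_mem {α : E} (hα : α ∈ Φ.roots) : -α ∈ Φ.roots := by
  simpa [refl, Submodule.reflection_orthogonalComplement_singleton_eq_neg] using
    Φ.refl_mem α hα α hα

/-- The finite Coxeter group `W` generated by the reflections in the roots, acting on `E = 𝔥^*`. -/
def weylGroup : Subgroup (E ≃ₗᵢ[ℝ] E) :=
  Subgroup.closure {s | ∃ α ∈ Φ.roots, s = refl α}

/-- The reflection `s_α ∈ W`. -/
def s (α : Φ.roots) : Φ.weylGroup :=
  ⟨refl (α : E), Subgroup.subset_closure ⟨α, α.2, rfl⟩⟩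

theorem weylGroup_mem (w : Φ.weylGroup) {α : E} (hα : α ∈ Φ.roots) :
    (w : E ≃ₗᵢ[ℝ] E) α ∈ Φ.roots := by
  obtain ⟨w, hw⟩ := w
  induction hw using Subgroup.closure_induction'' generalizing α with
  | mem x hx => obtain ⟨β, hβ, rfl⟩ := hx; exact Φ.refl_mem β hβ α hα
  | inv_mem x hx =>
    obtain ⟨β, hβ, rfl⟩ := hx
    have : (refl β)⁻¹ = refl β := Submodule.reflection_inv
    simpa [this] using Φ.refl_mem β hβ α hα
  | one => simpa using hα
  | mul x y _ _ hx hy => exact hx (hy hα)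

/-- The action of `W` on the set of roots. -/
def act (w : Φ.weylGroup) (α : Φ.roots) : Φ.roots :=
  ⟨(w : E ≃ₗᵢ[ℝ] E) α, Φ.weylGroup_mem w α.2⟩

/-- The root `-α`. -/
def neg (α : Φ.roots) : Φ.roots := ⟨-(α : E), Φ.neg_mem α.2⟩

theorem act_neg (w : Φ.weylGroup) (α : Φ.roots) : Φ.act w (Φ.neg α) = Φ.neg (Φ.act w α) := by
  ext; simp [act, neg]

theorem refl_map (w : E ≃ₗᵢ[ℝ] E) (α : E) : refl (w α) = w * refl α * w⁻¹ := by
  have h : (ℝ ∙ w α)ᗮ.reflection = w.symm.trans ((ℝ ∙ α)ᗮ.reflection.trans w) := by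
    ext x
    simp only [LinearIsometryEquiv.trans_apply, Submodule.reflection_orthogonal_apply,
      Submodule.reflection_singleton_apply, map_neg, map_sub, map_smul, two_smul, map_add,
      LinearIsometryEquiv.norm_map, LinearIsometryEquiv.apply_symm_apply]
    have : ⟪w α, x⟫_ℝ = ⟪α, w.symm x⟫_ℝ := by
      rw [← w.inner_map_map α, w.apply_symm_apply]
    rw [this]
  exact h

theorem s_act (w : Φ.weylGroup) (α : Φ.roots) : Φ.s (Φ.act w α) = w * Φ.s α * w⁻¹ :=
  Subtype.ext (refl_map _ _)

theorem s_neg (α : Φ.roots) : Φ.s (Φ.neg α) = Φ.s α := by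
  apply Subtype.ext
  show (ℝ ∙ (-(α : E)))ᗮ.reflection = (ℝ ∙ (α : E))ᗮ.reflection
  ext x
  simp [Submodule.reflection_orthogonal_apply, Submodule.reflection_singleton_apply, neg_div,
    sub_eq_add_neg]

/-- The subspace of `⨁_{α ∈ Δ} ℝ [α]` spanned by the elements `[α] + [-α]`. -/
def oddRel : Submodule ℝ (Φ.roots →₀ ℝ) :=
  Submodule.span ℝ (Set.range fun α => Finsupp.single α 1 + Finsupp.single (Φ.neg α) 1)

/-- The vector space `V = ⨁_{α ∈ Δ} ℝ [α] / ([α] + [-α])`. -/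
abbrev RootSpace : Type _ := (Φ.roots →₀ ℝ) ⧸ Φ.oddRel

/-- The element `[α] ∈ V`. -/
def bracket (α : Φ.roots) : Φ.RootSpace := Φ.oddRel.mkQ (Finsupp.single α 1)

theorem bracket_neg (α : Φ.roots) : Φ.bracket (Φ.neg α) = -Φ.bracket α := by
  rw [eq_neg_iff_add_eq_zero, add_comm]
  show Φ.oddRel.mkQ _ + Φ.oddRel.mkQ _ = 0
  rw [← map_add, Submodule.mkQ_apply, Submodule.Quotient.mk_eq_zero]
  exact Submodule.subset_span ⟨α, rfl⟩

/-- A linear map out of `V` is given by an odd function of the roots. -/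
def rootLift {M : Type*} [AddCommGroup M] [Module ℝ M] (f : Φ.roots → M)
    (hf : ∀ α, f (Φ.neg α) = -f α) : Φ.RootSpace →ₗ[ℝ] M :=
  Φ.oddRel.liftQ (Finsupp.linearCombination ℝ f) (by
    rw [oddRel, Submodule.span_le]
    rintro _ ⟨α, rfl⟩
    simp [hf])

@[simp] theorem rootLift_bracket {M : Type*} [AddCommGroup M] [Module ℝ M] (f : Φ.roots → M)
    (hf : ∀ α, f (Φ.neg α) = -f α) (α : Φ.roots) : Φ.rootLift f hf (Φ.bracket α) = f α := by
  simp [rootLift, bracket]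

theorem rootSpace_ext {M : Type*} [AddCommGroup M] [Module ℝ M] {f g : Φ.RootSpace →ₗ[ℝ] M}
    (h : ∀ α, f (Φ.bracket α) = g (Φ.bracket α)) : f = g := by
  apply Submodule.linearMap_qext
  ext α
  simpa [bracket] using h α

/-- The Yetter–Drinfeld module structure on `V` over `W`: `w [α] = [w α]`, and `[α]` is homogeneous
of degree `s_α`. -/
def yetterDrinfeld : YetterDrinfeld ℝ Φ.weylGroup Φ.RootSpace where
  action :=
    { toFun := fun w => Φ.rootLift (fun α => Φ.bracket (Φ.act w α)) fun α => by
        rw [act_neg, bracket_neg]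
      map_one' := Φ.rootSpace_ext fun α => by simp [act]
      map_mul' := fun w w' => Φ.rootSpace_ext fun α => by simp [act] }
  coaction := Φ.rootLift (fun α => Finsupp.single (Φ.s α) (Φ.bracket α)) fun α => by
    rw [s_neg, bracket_neg, Finsupp.single_neg]
  sum_coaction := by
    have h : (Finsupp.lsum ℝ fun _ : Φ.weylGroup => (LinearMap.id : Φ.RootSpace →ₗ[ℝ] _)) ∘ₗ
        (Φ.rootLift (fun α => Finsupp.single (Φ.s α) (Φ.bracket α)) fun α => by
          rw [s_neg, bracket_neg, Finsupp.single_neg]) = LinearMap.id :=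
      Φ.rootSpace_ext fun α => by simp
    exact fun v => LinearMap.congr_fun h v
  coaction_component := by
    intro v g
    set δ : Φ.RootSpace →ₗ[ℝ] (Φ.weylGroup →₀ Φ.RootSpace) :=
      Φ.rootLift (fun α => Finsupp.single (Φ.s α) (Φ.bracket α)) fun α => by
          rw [s_neg, bracket_neg, Finsupp.single_neg] with hδ
    have h : δ ∘ₗ Finsupp.lapply g ∘ₗ δ = Finsupp.lsingle g ∘ₗ Finsupp.lapply g ∘ₗ δ :=
      Φ.rootSpace_ext fun α => by
        by_cases hg : Φ.s α = g
        · subst hg; simp [hδ]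
        · simp [hδ, hg]
    exact LinearMap.congr_fun h v
  coaction_action := by
    intro g h v
    set δ : Φ.RootSpace →ₗ[ℝ] (Φ.weylGroup →₀ Φ.RootSpace) :=
      Φ.rootLift (fun α => Finsupp.single (Φ.s α) (Φ.bracket α)) fun α => by
          rw [s_neg, bracket_neg, Finsupp.single_neg] with hδ
    set a : Φ.RootSpace →ₗ[ℝ] Φ.RootSpace :=
      Φ.rootLift (fun α => Φ.bracket (Φ.act g α)) fun α => by rw [act_neg, bracket_neg] with ha
    have key : Finsupp.lapply (g * h * g⁻¹) ∘ₗ δ ∘ₗ a = a ∘ₗ Finsupp.lapply h ∘ₗ δ :=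
      Φ.rootSpace_ext fun α => by
        by_cases hh : Φ.s α = h
        · subst hh; simp [hδ, ha, s_act]
        · simp [hδ, ha, s_act, hh]
    exact LinearMap.congr_fun key v

/-- The braiding of `V` is `[α] ⊗ [β] ↦ [s_α β] ⊗ [α]`. -/
theorem braiding_bracket (α β : Φ.roots) :
    Φ.yetterDrinfeld.braiding (Φ.bracket α ⊗ₜ[ℝ] Φ.bracket β) =
      Φ.bracket (Φ.act (Φ.s α) β) ⊗ₜ[ℝ] Φ.bracket α := by
  rw [YetterDrinfeld.braiding_tmul]
  simp [yetterDrinfeld]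

/-- The Nichols–Woronowicz algebra `𝓑_W` of the Yetter–Drinfeld module `V`. -/
abbrev BW : Type _ := NicholsAlgebra Φ.yetterDrinfeld.braiding

/-! ### The extended algebras -/

/-- The ring `R = Sym 𝔥^*` of polynomial functions on `𝔥`, where `𝔥^* = E`. -/
abbrev R (E : Type*) [NormedAddCommGroup E] [InnerProductSpace ℝ E] : Type _ :=
  SymmetricAlgebra ℝ E

/-- The defining relations of `𝓑_W⟨R⟩[t]`, in the tensor algebra of the vector space
`𝓑_W × R[t]`: the first four say that `𝓑_W` and `R[t]` map to the quotient by algebra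
homomorphisms, so that these present the free product of `𝓑_W` and `R[t]`; the last two are
`[α] t = t [α]` and `[α] x = s_α(x) [α] + t (x, α)` for `x ∈ 𝔥^*`. -/
inductive ExtRel : TensorAlgebra ℝ (Φ.BW × Polynomial (R E)) →
    TensorAlgebra ℝ (Φ.BW × Polynomial (R E)) → Prop
  | nichols_one : ExtRel (TensorAlgebra.ι ℝ (1, 0)) 1
  | nichols_mul (a b : Φ.BW) : ExtRel (TensorAlgebra.ι ℝ (a * b, 0))
      (TensorAlgebra.ι ℝ (a, 0) * TensorAlgebra.ι ℝ (b, 0))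
  | poly_one : ExtRel (TensorAlgebra.ι ℝ (0, 1)) 1
  | poly_mul (f g : Polynomial (R E)) : ExtRel (TensorAlgebra.ι ℝ (0, f * g))
      (TensorAlgebra.ι ℝ (0, f) * TensorAlgebra.ι ℝ (0, g))
  | bracket_t (α : Φ.roots) : ExtRel
      (TensorAlgebra.ι ℝ (NicholsAlgebra.ι _ (Φ.bracket α), 0) *
        TensorAlgebra.ι ℝ (0, Polynomial.X))
      (TensorAlgebra.ι ℝ (0, Polynomial.X) *
        TensorAlgebra.ι ℝ (NicholsAlgebra.ι _ (Φ.bracket α), 0))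
  | bracket_x (α : Φ.roots) (x : E) : ExtRel
      (TensorAlgebra.ι ℝ (NicholsAlgebra.ι _ (Φ.bracket α), 0) *
        TensorAlgebra.ι ℝ (0, Polynomial.C (SymmetricAlgebra.ι ℝ E x)))
      (TensorAlgebra.ι ℝ (0, Polynomial.C (SymmetricAlgebra.ι ℝ E (refl (α : E) x))) *
          TensorAlgebra.ι ℝ (NicholsAlgebra.ι _ (Φ.bracket α), 0) +
        ⟪x, (α : E)⟫_ℝ • TensorAlgebra.ι ℝ (0, Polynomial.X))

/-- The extension `𝓑_W⟨R⟩[t]` of `𝓑_W` by `R[t]`. -/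
def ExtAlg : Type _ := RingQuot Φ.ExtRel

instance : Ring Φ.ExtAlg := inferInstanceAs (Ring (RingQuot Φ.ExtRel))

instance : Algebra ℝ Φ.ExtAlg := inferInstanceAs (Algebra ℝ (RingQuot Φ.ExtRel))

/-- The quotient map onto `𝓑_W⟨R⟩[t]`. -/
def ExtAlg.mk : TensorAlgebra ℝ (Φ.BW × Polynomial (R E)) →ₐ[ℝ] Φ.ExtAlg :=
  RingQuot.mkAlgHom ℝ Φ.ExtRel

theorem ExtAlg.mk_rel {a b : TensorAlgebra ℝ (Φ.BW × Polynomial (R E))} (h : Φ.ExtRel a b) :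
    ExtAlg.mk Φ a = ExtAlg.mk Φ b :=
  RingQuot.mkAlgHom_rel ℝ h

/-- The algebra homomorphism `𝓑_W → 𝓑_W⟨R⟩[t]`. -/
def ofNichols : Φ.BW →ₐ[ℝ] Φ.ExtAlg :=
  AlgHom.ofLinearMap
    ((ExtAlg.mk Φ).toLinearMap ∘ₗ TensorAlgebra.ι ℝ ∘ₗ LinearMap.inl ℝ _ _)
    (by simpa using ExtAlg.mk_rel Φ (ExtRel.nichols_one))
    (fun a b => by
      simpa using ExtAlg.mk_rel Φ (ExtRel.nichols_mul a b))

/-- The algebra homomorphism `R[t] → 𝓑_W⟨R⟩[t]`. -/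
def ofPoly : Polynomial (R E) →ₐ[ℝ] Φ.ExtAlg :=
  AlgHom.ofLinearMap
    ((ExtAlg.mk Φ).toLinearMap ∘ₗ TensorAlgebra.ι ℝ ∘ₗ LinearMap.inr ℝ _ _)
    (by simpa using ExtAlg.mk_rel Φ (ExtRel.poly_one))
    (fun a b => by
      simpa using ExtAlg.mk_rel Φ (ExtRel.poly_mul a b))

/-- The element `x ∈ 𝔥^*` of `𝓑_W⟨R⟩[t]`. -/
def extX : E →ₗ[ℝ] Φ.ExtAlg :=
  Φ.ofPoly.toLinearMap ∘ₗ (Polynomial.CAlgHom (R := ℝ) (A := R E)).toLinearMap ∘ₗ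
    SymmetricAlgebra.ι ℝ E

/-- The element `t` of `𝓑_W⟨R⟩[t]`. -/
def extT : Φ.ExtAlg := Φ.ofPoly Polynomial.X

/-- The element `[α]` of `𝓑_W⟨R⟩[t]`. -/
def extBracket (α : Φ.roots) : Φ.ExtAlg := Φ.ofNichols (NicholsAlgebra.ι _ (Φ.bracket α))

theorem extBracket_mul_extX (α : Φ.roots) (x : E) :
    Φ.extBracket α * Φ.extX x =
      Φ.extX (refl (α : E) x) * Φ.extBracket α + ⟪x, (α : E)⟫_ℝ • Φ.extT := by
  simpa [extBracket, extX, extT, ofNichols, ofPoly] using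
    ExtAlg.mk_rel Φ (ExtRel.bracket_x α x)

/-- The action of `W` on `R` by algebra automorphisms. -/
def actR (w : Φ.weylGroup) : R E →ₐ[ℝ] R E :=
  SymmetricAlgebra.lift
    (SymmetricAlgebra.ι ℝ E ∘ₗ ((w : E ≃ₗᵢ[ℝ] E).toLinearEquiv : E →ₗ[ℝ] E))

/-- The algebra `𝓑̃_W = 𝓑_W⟨R⟩[t] ⊗_{R^W} R`, as the quotient of `𝓑_W⟨R⟩[t] ⊗_ℝ R` by the relations
`f ⊗ 1 = 1 ⊗ f` for all `W`-invariant `f ∈ R`. -/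
def TildeAlg : Type _ :=
  RingQuot fun a b : Φ.ExtAlg ⊗[ℝ] R E =>
    ∃ f : R E, (∀ w, Φ.actR w f = f) ∧
      a = Φ.ofPoly (Polynomial.C f) ⊗ₜ[ℝ] 1 ∧ b = 1 ⊗ₜ[ℝ] f

instance : Ring Φ.TildeAlg := inferInstanceAs (Ring (RingQuot _))

instance : Algebra ℝ Φ.TildeAlg := inferInstanceAs (Algebra ℝ (RingQuot _))

/-- The canonical homomorphism `𝓑_W⟨R⟩[t] → 𝓑̃_W`, `a ↦ a ⊗ 1`. -/
def toTilde : Φ.ExtAlg →ₐ[ℝ] Φ.TildeAlg :=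
  (RingQuot.mkAlgHom ℝ _ : Φ.ExtAlg ⊗[ℝ] R E →ₐ[ℝ] Φ.TildeAlg).comp
    Algebra.TensorProduct.includeLeft

/-- The linear map `μ(x) = x + ∑_{α ∈ Δ₊} c_α (x, α) [α]`, where the positive roots are those on
which the linear form `ℓ` is positive. -/
def mu (ℓ : E →ₗ[ℝ] ℝ) (c : Φ.roots → ℝ) : E →ₗ[ℝ] Φ.ExtAlg where
  toFun x := Φ.extX x +
    ∑ α ∈ Finset.univ.filter (fun α : Φ.roots => 0 < ℓ (α : E)),
      (c α * ⟪x, (α : E)⟫_ℝ) • Φ.extBracket α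
  map_add' x y := by
    simp only [map_add, inner_add_left, mul_add, add_smul, Finset.sum_add_distrib]
    abel
  map_smul' r x := by
    simp only [map_smul, inner_smul_left, RingHom.id_apply, smul_add, Finset.smul_sum, smul_smul]
    congr 1
    refine Finset.sum_congr rfl fun α _ => ?_
    congr 1
    simp only [conj_trivial]
    ring

end EuclideanRootSystem

end NicholsWoronowicz

end

open scoped TensorProduct InnerProductSpace

noncomputable section

namespace NicholsWoronowicz

/-! Write `μ(x) = x + p(x)`, with `p(x)` the sum over positive roots. Then `[μ(x), μ(y)] = [x, y] +
([p(x), y] - [p(y), x]) + [p(x), p(y)]`, and the three terms vanish separately.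

The first vanishes because `R` is commutative. For the second, `[p(x), y]` is symmetric in `x` and
`y`, since each root contributes through `(x, α)(y, α)` alone (`posRootSum_commutator_extX`).

The third is a relation of degree two in the Nichols algebra, where the symmetrizer is `1 + Ψ`. Let
`S_x` be the sum over all roots, which equals `2 p(x)`. Unlike the positive roots, the index set of
`S_x` is stable under reflections, so it can be reindexed by `s_α`, giving `Ψ(S_x ⊗ S_y) = S_y ⊗ S_x
- K` with `K` symmetric in `x, y` (`braiding_rootSum_tmul_rootSum`). Hence `(1 + Ψ)(S_x ⊗ S_y)` is
symmetric as well. -/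

theorem quantumSymmetrizer_ι_mul_ι {k V : Type*} [Field k] [AddCommGroup V] [Module k V]
    (Ψ : V ⊗[k] V →ₗ[k] V ⊗[k] V) (u v : V) :
    quantumSymmetrizer Ψ (TensorAlgebra.ι k u * TensorAlgebra.ι k v) =
      mulTensor (TensorAlgebra.ι k) (u ⊗ₜ[k] v + Ψ (u ⊗ₜ[k] v)) := by
  have h1 : insert Ψ 1 = TensorAlgebra.ι k := LinearMap.ext (insert_one Ψ)
  have h : quantumSymmetrizer Ψ (TensorAlgebra.ι k v) = TensorAlgebra.ι k v := by
    simpa [quantumSymmetrizer_one, h1] using quantumSymmetrizer_ι_mul Ψ v 1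
  rw [quantumSymmetrizer_ι_mul, h]
  simpa [h1] using insert_ι_mul Ψ v u 1

/-- Elements of `V` commute in the Nichols algebra as soon as the degree two relation holds. -/
theorem NicholsAlgebra.ι_mul_comm {k V : Type*} [Field k] [AddCommGroup V] [Module k V]
    (Ψ : V ⊗[k] V →ₗ[k] V ⊗[k] V) {u v : V}
    (h : u ⊗ₜ[k] v + Ψ (u ⊗ₜ[k] v) = v ⊗ₜ[k] u + Ψ (v ⊗ₜ[k] u)) :
    NicholsAlgebra.ι Ψ u * NicholsAlgebra.ι Ψ v = NicholsAlgebra.ι Ψ v * NicholsAlgebra.ι Ψ u := by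
  show NicholsAlgebra.mk Ψ _ * NicholsAlgebra.mk Ψ _ = NicholsAlgebra.mk Ψ _ * NicholsAlgebra.mk Ψ _
  rw [← map_mul (NicholsAlgebra.mk Ψ), ← map_mul (NicholsAlgebra.mk Ψ)]
  -- The defining relation identifies tensors with equal symmetrizations.
  refine RingQuot.mkAlgHom_rel k ?_
  rw [quantumSymmetrizer_ι_mul_ι, quantumSymmetrizer_ι_mul_ι, h]

open scoped IsMulCommutative in
/-- A linear map with pairwise commuting values extends to the symmetric algebra. -/
theorem exists_algHom_of_commute {k M A : Type*} [CommRing k] [AddCommGroup M] [Module k M]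
    [Ring A] [Algebra k A] (f : M →ₗ[k] A) (hf : ∀ x y, f x * f y = f y * f x) :
    ∃ φ : SymmetricAlgebra k M →ₐ[k] A, ∀ x, φ (SymmetricAlgebra.ι k M x) = f x := by
  -- The universal property requires a commutative target, so `A` is replaced by the subalgebra
  -- generated by the image.
  let S : Subalgebra k A := Algebra.adjoin k (Set.range f)
  have : IsMulCommutative S := Algebra.isMulCommutative_adjoin k (by
    rintro _ ⟨x, rfl⟩ _ ⟨y, rfl⟩
    exact hf x y)
  let g : M →ₗ[k] S :=
    f.codRestrict (Subalgebra.toSubmodule S) fun x => Algebra.subset_adjoin ⟨x, rfl⟩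
  refine ⟨S.val.comp (SymmetricAlgebra.lift g), fun x => ?_⟩
  rw [AlgHom.comp_apply, SymmetricAlgebra.lift_ι_apply]
  rfl

theorem add_eq_add_of_add_eq_of_add_eq {A : Type*} [AddCommMonoid A] {a b p q r : A}
    (hp : p + r = b) (hq : q + r = a) : a + p = b + q := by
  rw [← hp, ← hq, add_comm, add_comm q r, add_assoc]

theorem refl_apply {E : Type*} [NormedAddCommGroup E] [InnerProductSpace ℝ E] (α x : E) :
    refl α x = x - (2 * (⟪x, α⟫_ℝ / ‖α‖ ^ 2)) • α := by
  simp only [refl, Submodule.reflection_orthogonal_apply, Submodule.reflection_singleton_apply,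
    real_inner_comm x α, two_smul, two_mul, add_smul, RCLike.ofReal_real_eq_id, id]
  abel

theorem inner_refl_right {E : Type*} [NormedAddCommGroup E] [InnerProductSpace ℝ E] (α x y : E) :
    ⟪x, refl α y⟫_ℝ = ⟪x, y⟫_ℝ - 2 * (⟪y, α⟫_ℝ / ‖α‖ ^ 2) * ⟪x, α⟫_ℝ := by
  rw [refl_apply, inner_sub_right, inner_smul_right]

namespace EuclideanRootSystem

variable {E : Type*} [NormedAddCommGroup E] [InnerProductSpace ℝ E] (Φ : EuclideanRootSystem E)

theorem act_s_self (α : Φ.roots) : Φ.act (Φ.s α) α = Φ.neg α := by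
  ext
  simp [act, s, neg, refl, Submodule.reflection_orthogonalComplement_singleton_eq_neg]

theorem act_s_involutive (α : Φ.roots) : Function.Involutive (Φ.act (Φ.s α)) := by
  intro β
  ext
  simp [act, s]

theorem neg_neg (α : Φ.roots) : Φ.neg (Φ.neg α) = α := by
  ext
  simp [neg]

/-! ### The quadratic relation in the Nichols algebra -/

/-- The element `∑_{α ∈ Δ} c_α (x, α) [α]` of `V`, the sum being over all roots. -/
def rootSum (c : Φ.roots → ℝ) (x : E) : Φ.RootSpace :=
  ∑ α : Φ.roots, (c α * ⟪x, (α : E)⟫_ℝ) • Φ.bracket α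

/-- The element `∑_{α ∈ Δ₊} c_α (x, α) [α]` of `V`. -/
def posRootSum (ℓ : E →ₗ[ℝ] ℝ) (c : Φ.roots → ℝ) (x : E) : Φ.RootSpace :=
  ∑ α ∈ Finset.univ.filter (fun α : Φ.roots => 0 < ℓ (α : E)),
    (c α * ⟪x, (α : E)⟫_ℝ) • Φ.bracket α

/-- Both `(x, α)` and `[α]` are odd in `α` and `c` is even, so `α` and `-α` contribute equally. -/
theorem rootSum_eq_two_smul (ℓ : E →ₗ[ℝ] ℝ) (hℓ : ∀ α ∈ Φ.roots, ℓ α ≠ 0) (c : Φ.roots → ℝ)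
    (hc : ∀ α, c (Φ.neg α) = c α) (x : E) :
    Φ.rootSum c x = (2 : ℝ) • Φ.posRootSum ℓ c x := by
  rw [rootSum, posRootSum, two_smul,
    ← Finset.sum_filter_add_sum_filter_not _ (fun α : Φ.roots => 0 < ℓ (α : E))]
  congr 1
  refine Finset.sum_bij' (fun α _ => Φ.neg α) (fun α _ => Φ.neg α) ?_ ?_ ?_ ?_ ?_
  · intro α hα
    have h := hℓ α α.2
    simp only [Finset.mem_filter_univ, not_lt] at hα
    simpa [neg] using lt_of_le_of_ne hα h
  · intro α hα
    simp only [Finset.mem_filter_univ] at hα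
    simpa [neg] using hα.le
  · exact fun α _ => Φ.neg_neg α
  · exact fun α _ => Φ.neg_neg α
  · intro α _
    rw [hc, bracket_neg]
    simp [neg]

theorem rootSum_tmul_rootSum (c : Φ.roots → ℝ) (x y : E) :
    Φ.rootSum c x ⊗ₜ[ℝ] Φ.rootSum c y =
      ∑ α : Φ.roots, ∑ β : Φ.roots, (c α * ⟪x, (α : E)⟫_ℝ * (c β * ⟪y, (β : E)⟫_ℝ)) •
        (Φ.bracket α ⊗ₜ[ℝ] Φ.bracket β) := by
  simp only [rootSum, TensorProduct.sum_tmul, TensorProduct.tmul_sum, TensorProduct.smul_tmul_smul]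
  exact Finset.sum_comm

/-- Reindexing by `s_α` turns `[s_α β]` into `[β]` and `(y, β)` into `(y, s_α β)`. The correction
term collects the differences `(y, β) - (y, s_α β)`, which are multiples of `(y, α)`. -/
theorem braiding_rootSum_tmul_rootSum (c : Φ.roots → ℝ)
    (hc : ∀ (w : Φ.weylGroup) (α : Φ.roots), c (Φ.act w α) = c α) (x y : E) :
    Φ.yetterDrinfeld.braiding (Φ.rootSum c x ⊗ₜ[ℝ] Φ.rootSum c y) +
        ∑ α : Φ.roots, ∑ β : Φ.roots,
          (c α * c β * (2 * (⟪(β : E), (α : E)⟫_ℝ / ‖(α : E)‖ ^ 2)) *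
            (⟪x, (α : E)⟫_ℝ * ⟪y, (α : E)⟫_ℝ)) • (Φ.bracket β ⊗ₜ[ℝ] Φ.bracket α) =
      Φ.rootSum c y ⊗ₜ[ℝ] Φ.rootSum c x := by
  rw [rootSum_tmul_rootSum, rootSum_tmul_rootSum Φ c y x, map_sum]
  -- On the right, the outer index must become the root in the second tensor factor, where `Ψ` puts
  -- `[α]`.
  rw [Finset.sum_comm (f := fun α β : Φ.roots => (c α * ⟪y, (α : E)⟫_ℝ * (c β * ⟪x, (β : E)⟫_ℝ)) •
    (Φ.bracket α ⊗ₜ[ℝ] Φ.bracket β)), ← Finset.sum_add_distrib]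
  refine Finset.sum_congr rfl fun α _ => ?_
  rw [map_sum, ← Equiv.sum_comp (Function.Involutive.toPerm _ (Φ.act_s_involutive α)),
    ← Finset.sum_add_distrib]
  refine Finset.sum_congr rfl fun β _ => ?_
  rw [map_smul, Function.Involutive.coe_toPerm, braiding_bracket, Φ.act_s_involutive α β, ← add_smul, hc]
  congr 1
  rw [show ((Φ.act (Φ.s α) β : Φ.roots) : E) = refl (α : E) β from rfl, inner_refl_right]
  ring

theorem nichols_rootSum_mul_comm (c : Φ.roots → ℝ)
    (hc : ∀ (w : Φ.weylGroup) (α : Φ.roots), c (Φ.act w α) = c α) (x y : E) :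
    NicholsAlgebra.ι Φ.yetterDrinfeld.braiding (Φ.rootSum c x) *
        NicholsAlgebra.ι Φ.yetterDrinfeld.braiding (Φ.rootSum c y) =
      NicholsAlgebra.ι Φ.yetterDrinfeld.braiding (Φ.rootSum c y) *
        NicholsAlgebra.ι Φ.yetterDrinfeld.braiding (Φ.rootSum c x) := by
  apply NicholsAlgebra.ι_mul_comm
  have hxy := Φ.braiding_rootSum_tmul_rootSum c hc x y
  have hyx := Φ.braiding_rootSum_tmul_rootSum c hc y x
  -- The correction terms of `hxy` and `hyx` now coincide.
  simp only [mul_comm ⟪x, _⟫_ℝ ⟪y, _⟫_ℝ] at hxy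
  exact add_eq_add_of_add_eq_of_add_eq hxy hyx

theorem nichols_posRootSum_mul_comm (ℓ : E →ₗ[ℝ] ℝ) (hℓ : ∀ α ∈ Φ.roots, ℓ α ≠ 0)
    (c : Φ.roots → ℝ) (hc : ∀ (w : Φ.weylGroup) (α : Φ.roots), c (Φ.act w α) = c α) (x y : E) :
    NicholsAlgebra.ι Φ.yetterDrinfeld.braiding (Φ.posRootSum ℓ c x) *
        NicholsAlgebra.ι Φ.yetterDrinfeld.braiding (Φ.posRootSum ℓ c y) =
      NicholsAlgebra.ι Φ.yetterDrinfeld.braiding (Φ.posRootSum ℓ c y) *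
        NicholsAlgebra.ι Φ.yetterDrinfeld.braiding (Φ.posRootSum ℓ c x) := by
  -- Evenness of `c` is a case of invariance, as `s_α α = -α`.
  have hneg : ∀ α, c (Φ.neg α) = c α := fun α => by rw [← act_s_self, hc]
  have key := Φ.nichols_rootSum_mul_comm c hc x y
  simp only [Φ.rootSum_eq_two_smul ℓ hℓ c hneg, map_smul, smul_mul_smul_comm] at key
  exact smul_right_injective _ (by norm_num : (2 * 2 : ℝ) ≠ 0) key

/-! ### Cross terms and commutativity of `μ` -/

theorem mu_apply (ℓ : E →ₗ[ℝ] ℝ) (c : Φ.roots → ℝ) (x : E) :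
    Φ.mu ℓ c x = Φ.extX x + Φ.ofNichols (NicholsAlgebra.ι _ (Φ.posRootSum ℓ c x)) := by
  simp [mu, posRootSum, extBracket]

/-- Since `x - s_α(x)` is `(x, α)` times a fixed multiple of `α`, the scalar `(x, α)` factors out
and what remains does not involve `x`. -/
theorem extBracket_commutator_extX (α : Φ.roots) (x : E) :
    Φ.extBracket α * Φ.extX x - Φ.extX x * Φ.extBracket α =
      ⟪x, (α : E)⟫_ℝ •
        (Φ.extT - (2 / ‖(α : E)‖ ^ 2) • (Φ.extX (α : E) * Φ.extBracket α)) := by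
  rw [extBracket_mul_extX, refl_apply, map_sub, map_smul, sub_mul, smul_mul_assoc, smul_sub,
    smul_smul]
  rw [show 2 * (⟪x, (α : E)⟫_ℝ / ‖(α : E)‖ ^ 2) = ⟪x, (α : E)⟫_ℝ * (2 / ‖(α : E)‖ ^ 2) by ring]
  abel

theorem posRootSum_commutator_extX (ℓ : E →ₗ[ℝ] ℝ) (c : Φ.roots → ℝ) (x y : E) :
    Φ.ofNichols (NicholsAlgebra.ι _ (Φ.posRootSum ℓ c x)) * Φ.extX y -
        Φ.extX y * Φ.ofNichols (NicholsAlgebra.ι _ (Φ.posRootSum ℓ c x)) =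
      ∑ α ∈ Finset.univ.filter (fun α : Φ.roots => 0 < ℓ (α : E)),
        (c α * (⟪x, (α : E)⟫_ℝ * ⟪y, (α : E)⟫_ℝ)) •
          (Φ.extT - (2 / ‖(α : E)‖ ^ 2) • (Φ.extX (α : E) * Φ.extBracket α)) := by
  have h : Φ.ofNichols (NicholsAlgebra.ι _ (Φ.posRootSum ℓ c x)) =
      ∑ α ∈ Finset.univ.filter (fun α : Φ.roots => 0 < ℓ (α : E)),
        (c α * ⟪x, (α : E)⟫_ℝ) • Φ.extBracket α := by
    simp [posRootSum, extBracket]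
  rw [h, Finset.sum_mul, Finset.mul_sum, ← Finset.sum_sub_distrib]
  refine Finset.sum_congr rfl fun α _ => ?_
  rw [smul_mul_assoc, mul_smul_comm, ← smul_sub, extBracket_commutator_extX, smul_smul, mul_assoc]

theorem extX_mul_comm (x y : E) : Φ.extX x * Φ.extX y = Φ.extX y * Φ.extX x := by
  simp only [extX, LinearMap.comp_apply, AlgHom.toLinearMap_apply]
  rw [← map_mul, mul_comm, map_mul]

theorem mu_mul_comm (ℓ : E →ₗ[ℝ] ℝ) (hℓ : ∀ α ∈ Φ.roots, ℓ α ≠ 0)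
    (c : Φ.roots → ℝ) (hc : ∀ (w : Φ.weylGroup) (α : Φ.roots), c (Φ.act w α) = c α) (x y : E) :
    Φ.mu ℓ c x * Φ.mu ℓ c y = Φ.mu ℓ c y * Φ.mu ℓ c x := by
  have hlin := Φ.posRootSum_commutator_extX ℓ c x y
  -- With the factors exchanged, the sum is the commutator formula for `(y, x)`, so `[p(x), y] =
  -- [p(y), x]`.
  simp only [mul_comm ⟪x, _⟫_ℝ ⟪y, _⟫_ℝ] at hlin
  rw [← posRootSum_commutator_extX] at hlin
  have hquad := congrArg Φ.ofNichols (Φ.nichols_posRootSum_mul_comm ℓ hℓ c hc x y)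
  rw [map_mul, map_mul] at hquad
  rw [mu_apply, mu_apply, add_mul, mul_add, mul_add, add_mul, mul_add, mul_add, hquad,
    Φ.extX_mul_comm x y]
  rw [sub_eq_iff_eq_add] at hlin
  rw [hlin]
  abel

end EuclideanRootSystem

end NicholsWoronowicz

end

theorem proposition5p1 {E : Type*} [NormedAddCommGroup E] [InnerProductSpace ℝ E]
    [FiniteDimensional ℝ E] (Φ : NicholsWoronowicz.EuclideanRootSystem E)
    (ℓ : E →ₗ[ℝ] ℝ) (hℓ : ∀ α ∈ Φ.roots, ℓ α ≠ 0)
    (c : Φ.roots → ℝ) (hc : ∀ (w : Φ.weylGroup) (α : Φ.roots), c (Φ.act w α) = c α) :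
    (∀ x y : E, Φ.mu ℓ c x * Φ.mu ℓ c y = Φ.mu ℓ c y * Φ.mu ℓ c x) ∧
    (∀ x y : E, Φ.toTilde (Φ.mu ℓ c x) * Φ.toTilde (Φ.mu ℓ c y) =
      Φ.toTilde (Φ.mu ℓ c y) * Φ.toTilde (Φ.mu ℓ c x)) ∧
    ∃ φ : SymmetricAlgebra ℝ E →ₐ[ℝ] Φ.ExtAlg,
      ∀ x : E, φ (SymmetricAlgebra.ι ℝ E x) = Φ.mu ℓ c x := by
  have h := Φ.mu_mul_comm ℓ hℓ c hc
  refine ⟨h, fun x y => ?_, NicholsWoronowicz.exists_algHom_of_commute (Φ.mu ℓ c) h⟩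
  rw [← map_mul, h, map_mul]
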